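/- A partition of a nonnegative integer $n$ is a finite multiset of positive integers (its parts) with sum $n$; let $p(n)$ be the number of partitions of $n$. The rank of a partition is its largest part minus its number of parts (the empty partition has rank $0$). For integers $t\ge 2$ and $0\le r<t$ let $N(r,t;n)$ be the number of partitions of $n$ whose rank is congruent to $r$ modulo $t$. **Theorem 1.1.** Fix integers $t\ge 2$ and $0\le r<t$. Then, as $n\to\infty$, $$N(r,t;n)\sim \frac{1}{t}\,p(n)\sim \frac{1}{4tn\sqrt3}\,e^{2\pi\sqrt{n/6}}.$$ Hence, for fixed $t$, the ranks of the partitions of $n$ are equidistributed modulo $t$ in the limit: $N(r,t;n)/p(n)\to 1/t$ as $n\to\infty$ for every $0\le r<t$. -/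

import Mathlib

open Filter Topology Asymptotics

/-- The partition function `p(n)`: the number of partitions of `n`. -/
def partitionCount (n : ℕ) : ℕ :=
  Fintype.card (Nat.Partition n)

/-- Dyson's rank of a partition: the largest part minus the number of parts.
The empty partition has largest part `0` by convention, hence rank `0`. -/
def dysonRank {n : ℕ} (l : Nat.Partition n) : ℤ :=
  (l.parts.sup : ℤ) - (Multiset.card l.parts : ℤ)

/-- `N(r,t;n)`: the number of partitions of `n` whose rank is congruent to `r` modulo `t`. -/
def rankCount (r t n : ℕ) : ℕ :=
  Fintype.card {l : Nat.Partition n // dysonRank l ≡ (r : ℤ) [ZMOD (t : ℤ)]}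

/-! Trading two parts 1 for one part 2 lowers the number of parts by one and, once some other part
is at least 2, leaves the largest part alone, so the rank rises by exactly one. Up to an error of
p(n) - p(n-2) + 1 this injects each rank class modulo t into the next (`rankCount_le_succ`). Going
round the cycle of residues, all t classes agree up to a multiple of that error. Equidistribution
thus follows from p(n-2)/p(n) → 1 and p(n) → ∞; no generating function of the rank is needed.

Both facts come from the Hardy–Ramanujan formula, which the theorem asserts as well. It is proved by
the saddle point method. Cauchy's formula (`two_pi_mul_partitionCount`) is rescaled to the width of
the saddle. The modular transformation of η (`partitionGF_exp_neg`) turns the integrand into a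
Gaussian times factors tending to 1 (`saddleIntegrand_eq`). An elementary bound on Euler's product
away from the positive axis (`norm_partitionGF_le`) controls the rest of the circle, and dominated
convergence gives the limit √π. -/

/-! ### Comparison of the rank classes -/

/-- Adjoin a multiset of positive parts to a partition. -/
def Nat.Partition.addParts {m n : ℕ} (s : Multiset ℕ) (hs : ∀ i ∈ s, 0 < i) (h : m + s.sum = n)
    (μ : Nat.Partition m) : Nat.Partition n where
  parts := μ.parts + s
  parts_pos hi := (Multiset.mem_add.1 hi).elim (fun h => μ.parts_pos h) (hs _)
  parts_sum := by simp [μ.parts_sum, h]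

lemma Nat.Partition.addParts_injective {m n : ℕ} (s : Multiset ℕ) (hs : ∀ i ∈ s, 0 < i)
    (h : m + s.sum = n) : Function.Injective (Nat.Partition.addParts s hs h) := by
  intro μ ν e
  have : μ.parts + s = ν.parts + s := congrArg Nat.Partition.parts e
  exact Nat.Partition.ext (add_right_cancel this)

lemma rankCount_eq_card_filter (r t n : ℕ) : rankCount r t n =
    (Finset.univ.filter fun l : Nat.Partition n => dysonRank l ≡ (r : ℤ) [ZMOD (t : ℤ)]).card := by
  rw [rankCount, Fintype.card_subtype]

lemma partitionCount_mono_two (m : ℕ) : partitionCount m ≤ partitionCount (m + 2) :=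
  Fintype.card_le_of_injective _
    (Nat.Partition.addParts_injective {1, 1} (by simp) (by simp))

/-- At most one partition of `m` has all parts equal to `1`. -/
lemma card_filter_parts_sup_le_one (m : ℕ) :
    (Finset.univ.filter fun μ : Nat.Partition m => ¬ 2 ≤ μ.parts.sup).card ≤ 1 := by
  refine Finset.card_le_one.2 fun μ hμ ν hν => ?_
  have key : ∀ μ : Nat.Partition m, ¬ 2 ≤ μ.parts.sup → μ.parts = Multiset.replicate m 1 := by
    intro μ h
    have h1 : ∀ i ∈ μ.parts, i = 1 := fun i hi => by
      have := Multiset.le_sup hi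
      have := μ.parts_pos hi
      omega
    have h2 := Multiset.eq_replicate_card.2 h1
    have h3 : Multiset.card μ.parts = m := by
      have := μ.parts_sum
      rw [h2] at this
      simpa using this
    rw [h3] at h2
    exact h2
  exact Nat.Partition.ext ((key μ (by simpa using hμ)).trans (key ν (by simpa using hν)).symm)

/-- The map `f μ ↦ g μ` replaces 1 + 1 by 2. The difference p(m+2) - p(m) pays for the partitions
outside the image of `f`, and the final 1 for the single μ without a part larger than 1, where the
rank shift may fail. -/
lemma rankCount_le_succ (r t m : ℕ) :
    rankCount r t (m + 2) + partitionCount m ≤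
      rankCount (r + 1) t (m + 2) + partitionCount (m + 2) + 1 := by
  classical
  set f : Nat.Partition m → Nat.Partition (m + 2) :=
    Nat.Partition.addParts {1, 1} (by simp) (by simp) with hf
  set g : Nat.Partition m → Nat.Partition (m + 2) :=
    Nat.Partition.addParts {2} (by simp) (by simp) with hg
  have hfi : Function.Injective f := Nat.Partition.addParts_injective _ _ _
  have hgi : Function.Injective g := Nat.Partition.addParts_injective _ _ _
  have hrank : ∀ μ : Nat.Partition m, 2 ≤ μ.parts.sup → dysonRank (g μ) = dysonRank (f μ) + 1 := by
    intro μ h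
    have h1 : (g μ).parts = μ.parts + {2} := rfl
    have h2 : (f μ).parts = μ.parts + {1, 1} := rfl
    have e1 : (μ.parts + {2}).sup = μ.parts.sup := by
      rw [Multiset.sup_add]; simpa using h
    have e2 : (μ.parts + {1, 1}).sup = μ.parts.sup := by
      rw [Multiset.sup_add]; simp; omega
    simp only [dysonRank, h1, h2, e1, e2]
    simp
    ring
  set R := Finset.univ.filter fun l : Nat.Partition (m + 2) =>
    dysonRank l ≡ (r : ℤ) [ZMOD (t : ℤ)] with hR
  set R' := Finset.univ.filter fun l : Nat.Partition (m + 2) =>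
    dysonRank l ≡ ((r + 1 : ℕ) : ℤ) [ZMOD (t : ℤ)] with hR'
  set T := Finset.univ.filter fun μ : Nat.Partition m => f μ ∈ R with hT
  -- Inclusion–exclusion for `R` and the image of `f`.
  have h1 : R.card + partitionCount m ≤ T.card + partitionCount (m + 2) := by
    have e1 : (R ∩ Finset.univ.image f).card ≤ T.card := by
      rw [← Finset.card_image_of_injective T hfi]
      refine Finset.card_le_card fun l hl => ?_
      simp only [Finset.mem_inter, Finset.mem_image, Finset.mem_univ, true_and] at hl
      obtain ⟨hl, μ, rfl⟩ := hl
      exact Finset.mem_image_of_mem f (by simp [hT, hl])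
    have e2 : (Finset.univ.image f).card = partitionCount m := by
      rw [Finset.card_image_of_injective _ hfi, Finset.card_univ, partitionCount]
    have e3 := Finset.card_union_add_card_inter R (Finset.univ.image f)
    have e4 : (R ∪ Finset.univ.image f).card ≤ partitionCount (m + 2) := Finset.card_le_univ _
    omega
  have h2 : T.card ≤ R'.card + 1 := by
    have e1 := Finset.card_filter_add_card_filter_not (s := T) (fun μ => 2 ≤ μ.parts.sup)
    have e2 : (T.filter fun μ => ¬ 2 ≤ μ.parts.sup).card ≤ 1 :=
      (Finset.card_le_card (Finset.filter_subset_filter _ (Finset.subset_univ _))).trans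
        (card_filter_parts_sup_le_one m)
    have e3 : (T.filter fun μ => 2 ≤ μ.parts.sup).card ≤ R'.card := by
      refine Finset.card_le_card_of_injOn g (fun μ hμ => ?_) hgi.injOn
      simp only [hT, hR, Finset.coe_filter, Finset.mem_filter, Finset.mem_univ, true_and,
        Set.mem_ofPred_eq] at hμ
      simp only [hR', Finset.coe_filter, Finset.mem_univ, true_and, Set.mem_ofPred_eq]
      rw [hrank μ hμ.2]
      push_cast
      exact hμ.1.add_right 1
    omega
  rw [rankCount_eq_card_filter, rankCount_eq_card_filter]
  change R.card + _ ≤ R'.card + _ + _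
  omega

lemma sum_rankCount (t n : ℕ) (ht : 0 < t) :
    ∑ r ∈ Finset.range t, rankCount r t n = partitionCount n := by
  classical
  simp only [rankCount_eq_card_filter]
  rw [partitionCount, ← Finset.card_univ]
  have ht' : (0 : ℤ) < t := by exact_mod_cast ht
  rw [Finset.card_eq_sum_card_fiberwise (f := fun l => (dysonRank l % t).toNat)
    (t := Finset.range t)]
  · refine Finset.sum_congr rfl fun r hr => ?_
    congr 1
    ext l
    have := Int.emod_nonneg (dysonRank l) ht'.ne'
    have hr' : (r : ℤ) < t := by exact_mod_cast Finset.mem_range.1 hr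
    have e : (r : ℤ) % t = r := Int.emod_eq_of_lt (by omega) hr'
    simp only [Finset.mem_filter, Finset.mem_univ, true_and, Int.ModEq, e]
    omega
  · intro l _
    have := Int.emod_lt_of_pos (dysonRank l) ht'
    have := Int.emod_nonneg (dysonRank l) ht'.ne'
    simp
    omega

lemma rankCount_le_add (r k t m : ℕ) :
    (rankCount r t (m + 2) : ℝ) ≤ rankCount (r + k) t (m + 2) +
      k * ((partitionCount (m + 2) : ℝ) - partitionCount m + 1) := by
  induction k with
  | zero => simp
  | succ k ih =>
    have h : (rankCount (r + k) t (m + 2) : ℝ) + partitionCount m ≤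
      rankCount (r + k + 1) t (m + 2) + partitionCount (m + 2) + 1 := by
        exact_mod_cast rankCount_le_succ (r + k) t m
    push_cast
    rw [← add_assoc]
    linarith

lemma rankCount_add_modulus (r t n : ℕ) : rankCount (t + r) t n = rankCount r t n := by
  rw [rankCount_eq_card_filter, rankCount_eq_card_filter]
  have h : ((t + r : ℕ) : ℤ) ≡ r [ZMOD t] := by simp [Int.ModEq]
  congr 1
  ext l
  simp only [Finset.mem_filter, Finset.mem_univ, true_and]
  exact ⟨fun h' => h'.trans h, fun h' => h'.trans h.symm⟩

/-- The rank classes modulo `t` differ in size by at most a multiple of `p(n) - p(n - 2) + 1`. -/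
lemma abs_mul_rankCount_sub_partitionCount_le (r t m : ℕ) (hr : r < t) :
    |(t : ℝ) * rankCount r t (m + 2) - partitionCount (m + 2)| ≤
      2 * t ^ 2 * ((partitionCount (m + 2) : ℝ) - partitionCount m + 1) := by
  set E : ℝ := (partitionCount (m + 2) : ℝ) - partitionCount m + 1
  have hE : 0 ≤ E := by
    have : (partitionCount m : ℝ) ≤ partitionCount (m + 2) := by
      exact_mod_cast partitionCount_mono_two m
    simp only [E]; linarith
  have key : ∀ a < t, ∀ b < t,
      (rankCount a t (m + 2) : ℝ) - rankCount b t (m + 2) ≤ 2 * t * E := by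
    intro a ha b hb
    -- Moving forward from a to t + b reaches the class of b in at most 2t steps, so inequalities in
    -- one direction suffice.
    have h := rankCount_le_add a (t - a + b) t m
    rw [show a + (t - a + b) = t + b by omega, rankCount_add_modulus] at h
    have h2 : ((t - a + b : ℕ) : ℝ) ≤ 2 * t := by
      have : t - a + b ≤ 2 * t := by omega
      exact_mod_cast this
    have := mul_le_mul_of_nonneg_right h2 hE
    simp only [E] at *
    linarith
  have hs : (partitionCount (m + 2) : ℝ) = ∑ k ∈ Finset.range t, (rankCount k t (m + 2) : ℝ) := by
    rw [← sum_rankCount t (m + 2) (by omega)]; push_cast; rfl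
  have ht : (t : ℝ) * rankCount r t (m + 2) - partitionCount (m + 2) =
      ∑ k ∈ Finset.range t, ((rankCount r t (m + 2) : ℝ) - rankCount k t (m + 2)) := by
    rw [Finset.sum_sub_distrib, hs]; simp
  rw [ht]
  refine (Finset.abs_sum_le_sum_abs _ _).trans ?_
  refine (Finset.sum_le_sum (g := fun _ => 2 * (t : ℝ) * E) fun k hk => ?_).trans ?_
  · have hk := Finset.mem_range.1 hk
    exact abs_le.2 ⟨by linarith [key k hk r hr], key r hr k hk⟩
  · simp only [Finset.sum_const, Finset.card_range, nsmul_eq_mul]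
    exact le_of_eq (by ring)

/-! ### Euler's product for the generating function -/

/-- The number of partitions of `n` into parts of size at most `N`. -/
def boundedPartitionCount (N n : ℕ) : ℕ := (Nat.Partition.restricted n (· ≤ N)).card

lemma boundedPartitionCount_le (N n : ℕ) : boundedPartitionCount N n ≤ partitionCount n :=
  Finset.card_le_univ _

lemma boundedPartitionCount_eq {N n : ℕ} (h : n ≤ N) :
    boundedPartitionCount N n = partitionCount n := by
  rw [boundedPartitionCount, partitionCount, Nat.Partition.restricted, Finset.filter_true_of_mem,
    Finset.card_univ]
  exact fun l _ i hi => (Nat.Partition.le_of_mem_parts hi).trans h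

lemma boundedPartitionCount_zero (n : ℕ) :
    boundedPartitionCount 0 n = if n = 0 then 1 else 0 := by
  split_ifs with h
  · subst h
    rw [boundedPartitionCount_eq le_rfl, partitionCount]
    simp
  · rw [boundedPartitionCount, Finset.card_eq_zero, Nat.Partition.restricted,
      Finset.filter_eq_empty_iff]
    intro l _ hl
    have h0 : l.parts = 0 := Multiset.eq_zero_of_forall_notMem fun i hi => by
      have := l.parts_pos hi
      have := hl i hi
      omega
    have := l.parts_sum
    rw [h0] at this
    exact h (by simpa using this.symm)

lemma boundedPartitionCount_succ_of_lt {N n : ℕ} (h : n < N + 1) :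
    boundedPartitionCount (N + 1) n = boundedPartitionCount N n := by
  rw [boundedPartitionCount_eq h.le, boundedPartitionCount_eq (by omega)]

/-- Split according to whether N + 1 occurs as a part; if it does, remove one copy. -/
lemma boundedPartitionCount_succ_add (N k : ℕ) :
    boundedPartitionCount (N + 1) (k + (N + 1)) =
      boundedPartitionCount N (k + (N + 1)) + boundedPartitionCount (N + 1) k := by
  classical
  set S := Nat.Partition.restricted (k + (N + 1)) (· ≤ N + 1) with hS
  have h1 := Finset.card_filter_add_card_filter_not (s := S) (fun l => N + 1 ∈ l.parts)
  have h2 : S.filter (fun l => ¬ N + 1 ∈ l.parts) =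
      Nat.Partition.restricted (k + (N + 1)) (· ≤ N) := by
    ext l
    simp only [hS, Nat.Partition.restricted, Finset.mem_filter, Finset.mem_univ, true_and]
    refine ⟨fun h i hi => ?_, fun h => ⟨fun i hi => (h i hi).trans (by omega), fun hm => ?_⟩⟩
    · have := h.1 i hi
      have : i ≠ N + 1 := fun e => h.2 (e ▸ hi)
      omega
    · have := h _ hm
      omega
  have h3 : (S.filter (fun l => N + 1 ∈ l.parts)).card = boundedPartitionCount (N + 1) k := by
    rw [boundedPartitionCount]
    symm
    refine Finset.card_bij (fun μ _ => Nat.Partition.addParts {N + 1} (by simp) (by simp) μ)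
      ?_ ?_ ?_
    · intro μ hμ
      simp only [Nat.Partition.restricted, Finset.mem_filter, Finset.mem_univ, true_and] at hμ
      simp only [hS, Nat.Partition.restricted, Finset.mem_filter, Finset.mem_univ, true_and,
        Nat.Partition.addParts, Multiset.mem_add, Multiset.mem_singleton, or_true, and_true]
      exact fun i hi => hi.elim (hμ i) (fun h => h.le)
    · exact fun μ _ ν _ e => Nat.Partition.addParts_injective _ _ _ e
    · intro l hl
      simp only [hS, Nat.Partition.restricted, Finset.mem_filter, Finset.mem_univ, true_and] at hl
      obtain ⟨s, hs⟩ := Multiset.exists_cons_of_mem hl.2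
      have hsum := l.parts_sum
      rw [hs, Multiset.sum_cons] at hsum
      refine ⟨⟨s, fun {i} hi => l.parts_pos (hs ▸ Multiset.mem_cons_of_mem hi), by omega⟩, ?_, ?_⟩
      · simp only [Nat.Partition.restricted, Finset.mem_filter, Finset.mem_univ, true_and]
        exact fun i hi => hl.1 i (hs ▸ Multiset.mem_cons_of_mem hi)
      · apply Nat.Partition.ext
        simp only [Nat.Partition.addParts]
        rw [hs, add_comm, Multiset.singleton_add]
  rw [h2, h3] at h1
  rw [boundedPartitionCount, ← hS, ← h1, add_comm]
  rfl

lemma boundedPartitionCount_le_pow (N n : ℕ) : boundedPartitionCount N n ≤ (n + 1) ^ N := by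
  induction N generalizing n with
  | zero => rw [boundedPartitionCount_zero]; split_ifs <;> simp
  | succ N ih =>
    induction n using Nat.strong_induction_on with
    | _ n ihn =>
      rcases lt_or_ge n (N + 1) with h | h
      · rw [boundedPartitionCount_succ_of_lt h]
        exact (ih n).trans (Nat.pow_le_pow_right (by omega) (by omega))
      · obtain ⟨k, rfl⟩ := Nat.exists_eq_add_of_le' h
        rw [boundedPartitionCount_succ_add]
        have h1 := ih (k + (N + 1))
        have h2 := ihn k (by omega)
        have h3 : (k + 1) ^ (N + 1) ≤ (k + (N + 1)) * (k + (N + 1) + 1) ^ N := by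
          rw [pow_succ, mul_comm]
          exact Nat.mul_le_mul (by omega) (Nat.pow_le_pow_left (by omega) _)
        calc _ ≤ (k + (N + 1) + 1) ^ N + (k + (N + 1)) * (k + (N + 1) + 1) ^ N :=
              Nat.add_le_add h1 (h2.trans h3)
          _ = _ := by rw [pow_succ]; ring

lemma summable_boundedPartitionCount (N : ℕ) {q : ℂ} (hq : ‖q‖ < 1) :
    Summable fun n => (boundedPartitionCount N n : ℂ) * q ^ n := by
  have h : Summable fun n : ℕ => ((n + 1 : ℕ) : ℝ) ^ N * ‖q‖ ^ (n + 1) :=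
    (summable_nat_add_iff (f := fun n : ℕ => (n : ℝ) ^ N * ‖q‖ ^ n) 1).2
      (summable_pow_mul_geometric_of_norm_lt_one N (by simpa using hq))
  -- The majorant carries one surplus factor ‖q‖, to be divided out, so q = 0 is separate.
  rcases eq_or_ne q 0 with rfl | h0
  · exact summable_of_ne_finset_zero (s := {0}) fun n hn => by simp at hn; simp [hn]
  have h' := h.mul_right ‖q‖⁻¹
  refine Summable.of_norm_bounded h' fun n => ?_
  rw [pow_succ, ← mul_assoc, mul_assoc, mul_inv_cancel₀ (by simpa using h0), mul_one, norm_mul,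
    norm_pow, Complex.norm_natCast]
  gcongr
  exact_mod_cast boundedPartitionCount_le_pow N n

lemma one_sub_pow_succ_ne_zero {q : ℂ} (hq : ‖q‖ < 1) (n : ℕ) : 1 - q ^ (n + 1) ≠ 0 := by
  intro h
  have h4 : ‖q ^ (n + 1)‖ < 1 := by
    rw [norm_pow]; exact pow_lt_one₀ (norm_nonneg _) hq (by omega)
  rw [← sub_eq_zero.1 h] at h4
  simp at h4

/-- The recurrence says that the sums satisfy (1 - q^(N+1)) S_(N+1) = S_N. -/
lemma hasSum_boundedPartitionCount (N : ℕ) {q : ℂ} (hq : ‖q‖ < 1) :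
    HasSum (fun n => (boundedPartitionCount N n : ℂ) * q ^ n)
      (∏ i ∈ Finset.range N, (1 - q ^ (i + 1)))⁻¹ := by
  induction N with
  | zero =>
    simp only [Finset.range_zero, Finset.prod_empty, inv_one]
    convert! hasSum_single (f := fun n => (boundedPartitionCount 0 n : ℂ) * q ^ n) 0 ?_ using 1
    · simp [boundedPartitionCount_zero]
    · intro n hn; simp [boundedPartitionCount_zero, hn]
  | succ N ih =>
    obtain ⟨S, hS⟩ := summable_boundedPartitionCount (N + 1) hq
    have h1 : HasSum (fun n => (boundedPartitionCount (N + 1) n : ℂ) * q ^ n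
        - (boundedPartitionCount N n : ℂ) * q ^ n) (q ^ (N + 1) * S) := by
      rw [← hasSum_nat_add_iff' (N + 1)]
      have h0 : ∑ i ∈ Finset.range (N + 1), ((boundedPartitionCount (N + 1) i : ℂ) * q ^ i
        - (boundedPartitionCount N i : ℂ) * q ^ i) = 0 := Finset.sum_eq_zero fun i hi => by
          rw [boundedPartitionCount_succ_of_lt (Finset.mem_range.1 hi), sub_self]
      rw [h0, sub_zero]
      convert! hS.mul_left (q ^ (N + 1)) using 2 with k
      rw [boundedPartitionCount_succ_add]
      push_cast
      ring
    have h2 := h1.unique (hS.sub ih)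
    have h3 := one_sub_pow_succ_ne_zero hq N
    have h5 : S = (∏ i ∈ Finset.range (N + 1), (1 - q ^ (i + 1)))⁻¹ := by
      rw [Finset.prod_range_succ, mul_inv, eq_mul_inv_iff_mul_eq₀ h3]
      linear_combination -h2
    rwa [h5] at hS

lemma eulerProduct_ne_zero {q : ℂ} (hq : ‖q‖ < 1) : ∏' n : ℕ, (1 - q ^ (n + 1)) ≠ 0 := by
  simp only [sub_eq_add_neg]
  refine tprod_one_add_ne_zero_of_summable (f := fun n : ℕ ↦ -q ^ (n + 1)) ?_ ?_
  · exact fun i ↦ by simpa [sub_eq_add_neg] using one_sub_pow_succ_ne_zero hq i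
  · simpa using (summable_nat_add_iff 1).mpr (summable_geometric_of_lt_one (norm_nonneg _) hq)

lemma tendsto_prod_inv {q : ℂ} (hq : ‖q‖ < 1) :
    Tendsto (fun N => (∏ i ∈ Finset.range N, (1 - q ^ (i + 1)))⁻¹) atTop
      (𝓝 (∏' n : ℕ, (1 - q ^ (n + 1)))⁻¹) :=
  (ModularForm.multipliable_one_sub_pow hq).hasProd.tendsto_prod_nat.inv₀ (eulerProduct_ne_zero hq)

/-- The first M terms do not see the restriction to parts of size at most M, so they are bounded by
a finite product, and these products converge. -/
lemma summable_partitionCount_real {r : ℝ} (h0 : 0 ≤ r) (h1 : r < 1) :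
    Summable fun n => (partitionCount n : ℝ) * r ^ n := by
  have hq : ‖(r : ℂ)‖ < 1 := by simpa [abs_of_nonneg h0] using h1
  obtain ⟨C, hC⟩ := (tendsto_prod_inv hq).norm.bddAbove_range
  refine summable_of_sum_range_le (c := C) (fun n => by positivity) fun M => ?_
  have h2 := hasSum_boundedPartitionCount M hq
  have h3 : HasSum (fun n => (boundedPartitionCount M n : ℝ) * r ^ n)
      (∏ i ∈ Finset.range M, (1 - r ^ (i + 1)))⁻¹ := by
    rw [← Complex.hasSum_ofReal]
    push_cast
    exact h2
  calc ∑ n ∈ Finset.range M, (partitionCount n : ℝ) * r ^ n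
      = ∑ n ∈ Finset.range M, (boundedPartitionCount M n : ℝ) * r ^ n := by
        refine Finset.sum_congr rfl fun n hn => ?_
        rw [boundedPartitionCount_eq (Finset.mem_range.1 hn).le]
    _ ≤ (∏ i ∈ Finset.range M, (1 - r ^ (i + 1)))⁻¹ :=
        sum_le_hasSum _ (fun n _ => by positivity) h3
    _ ≤ ‖(∏ i ∈ Finset.range M, (1 - (r : ℂ) ^ (i + 1)))⁻¹‖ := by
        refine (le_abs_self _).trans (le_of_eq ?_)
        rw [← Real.norm_eq_abs, ← Complex.norm_real]
        push_cast
        rfl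
    _ ≤ C := hC ⟨M, rfl⟩

lemma summable_norm_partitionCount {q : ℂ} (hq : ‖q‖ < 1) :
    Summable fun n => ‖(partitionCount n : ℂ) * q ^ n‖ := by
  simpa using summable_partitionCount_real (norm_nonneg q) hq

/-- The generating function of partitions as an analytic function on the unit disc. -/
noncomputable def partitionGF (q : ℂ) : ℂ := (∏' n : ℕ, (1 - q ^ (n + 1)))⁻¹

/-- Euler's product for the generating function of partitions. -/
lemma hasSum_partitionCount {q : ℂ} (hq : ‖q‖ < 1) :
    HasSum (fun n => (partitionCount n : ℂ) * q ^ n) (partitionGF q) := by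
  have hs := summable_norm_partitionCount hq
  have h1 : Tendsto (fun N => ∑' n, (boundedPartitionCount N n : ℂ) * q ^ n) atTop
      (𝓝 (∑' n, (partitionCount n : ℂ) * q ^ n)) := by
    refine tendsto_tsum_of_dominated_convergence hs (fun n => ?_) (Eventually.of_forall fun N n => ?_)
    · refine tendsto_const_nhds.congr' ?_
      filter_upwards [eventually_ge_atTop n] with N hN
      rw [boundedPartitionCount_eq hN]
    · rw [norm_mul, norm_mul, Complex.norm_natCast, Complex.norm_natCast]
      gcongr
      exact boundedPartitionCount_le N n
  have h2 : ∀ N, ∑' n, (boundedPartitionCount N n : ℂ) * q ^ n =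
      (∏ i ∈ Finset.range N, (1 - q ^ (i + 1)))⁻¹ :=
    fun N => (hasSum_boundedPartitionCount N hq).tsum_eq
  simp only [h2] at h1
  have h3 := tendsto_nhds_unique h1 (tendsto_prod_inv hq)
  rw [partitionGF, ← h3]
  exact hs.of_norm.hasSum

/-! ### Behaviour at the origin and modular transformation -/

lemma continuousOn_partitionGF : ContinuousOn partitionGF (Metric.ball 0 1) :=
  ModularForm.differentiableOn_tprod_one_sub_pow.continuousOn.inv₀
    fun q hq => eulerProduct_ne_zero (by simpa using hq)

lemma partitionGF_zero : partitionGF 0 = 1 := by simp [partitionGF]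

lemma tendsto_partitionGF_zero : Tendsto partitionGF (𝓝 0) (𝓝 1) := by
  have := (continuousOn_partitionGF.continuousAt (Metric.ball_mem_nhds 0 one_pos)).tendsto
  rwa [partitionGF_zero] at this

lemma eta_mul_partitionGF {z : ℂ} (hz : z ∈ UpperHalfPlane.upperHalfPlaneSet) :
    ModularForm.eta z * partitionGF (Function.Periodic.qParam 1 z) =
      Function.Periodic.qParam 24 z := by
  rw [ModularForm.eta, partitionGF, mul_assoc, mul_inv_cancel₀, mul_one]
  exact ModularForm.eta_tprod_ne_zero hz

/-- The arguments π/2 and arg w < π/2 add up without crossing the branch cut. -/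
lemma Complex.sqrt_I_mul {w : ℂ} (hw : 0 < w.re) :
    Complex.sqrt (Complex.I * w) = Complex.sqrt Complex.I * Complex.sqrt w := by
  have hw0 : w ≠ 0 := fun h => by simp [h] at hw
  have h := Complex.abs_arg_lt_pi_div_two_iff.2 (Or.inl hw)
  rw [abs_lt] at h
  have hlog : Complex.log (Complex.I * w) = Complex.log Complex.I + Complex.log w := by
    refine Complex.log_mul Complex.I_ne_zero hw0 ?_
    rw [Complex.arg_I]
    constructor <;> linarith [Real.pi_pos]
  rw [_root_.sqrt_eq_exp (mul_ne_zero Complex.I_ne_zero hw0), _root_.sqrt_eq_exp Complex.I_ne_zero,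
    _root_.sqrt_eq_exp hw0, hlog, add_div, Complex.exp_add]

/-- The modular transformation of the partition generating function, from that of `η`. -/
lemma partitionGF_exp_neg {s : ℂ} (hs : 0 < s.re) :
    partitionGF (Complex.exp (-s)) = Complex.sqrt (s / (2 * Real.pi)) *
      Complex.exp (Real.pi ^ 2 / (6 * s) - s / 24) *
      partitionGF (Complex.exp (-(4 * Real.pi ^ 2 / s))) := by
  have hs0 : s ≠ 0 := fun h => by simp [h] at hs
  have hpi : (Real.pi : ℂ) ≠ 0 := by exact_mod_cast Real.pi_ne_zero
  have hw : 0 < (s / (2 * Real.pi)).re := by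
    have : s / (2 * Real.pi) = s / ((2 * Real.pi : ℝ) : ℂ) := by push_cast; rfl
    rw [this, Complex.div_ofReal_re]
    positivity
  -- Chosen so that e^(2πiτ) = e^(-s); then -1/τ corresponds to e^(-4π²/s).
  set τ : ℂ := Complex.I * (s / (2 * Real.pi)) with hτ
  have hτm : τ ∈ UpperHalfPlane.upperHalfPlaneSet := by
    change 0 < τ.im
    simpa [hτ] using hw
  have hτ' : -1 / τ = 2 * Real.pi * Complex.I / s := by
    rw [hτ]
    field_simp
    simp
  have hτm' : -1 / τ ∈ UpperHalfPlane.upperHalfPlaneSet := by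
    change 0 < (-1 / τ).im
    rw [neg_div, one_div, Complex.neg_im, Complex.inv_im, neg_div, neg_neg]
    have h1 : 0 < τ.im := hτm
    have h2 : 0 < Complex.normSq τ := Complex.normSq_pos.2 fun h => by simp [h] at h1
    positivity
  have e1 := eta_mul_partitionGF hτm
  have e2 := eta_mul_partitionGF hτm'
  have e3 : ModularForm.eta (-1 / τ) =
      (Complex.sqrt Complex.I)⁻¹ * (Complex.sqrt τ * ModularForm.eta τ) := by
    simpa using ModularForm.eta_comp_eq_csqrt_I_inv hτm
  have hI : Complex.sqrt Complex.I ≠ 0 := by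
    rw [_root_.sqrt_eq_exp Complex.I_ne_zero]; exact Complex.exp_ne_zero _
  rw [hτ, Complex.sqrt_I_mul hw, ← hτ, mul_assoc, inv_mul_cancel_left₀ hI] at e3
  have q1 : Function.Periodic.qParam 1 τ = Complex.exp (-s) := by
    rw [Function.Periodic.qParam, hτ]
    congr 1
    field_simp
    simp
  have q2 : Function.Periodic.qParam 24 τ = Complex.exp (-(s / 24)) := by
    rw [Function.Periodic.qParam, hτ]
    congr 1
    push_cast
    field_simp
    simp
  have q3 : Function.Periodic.qParam 1 (-1 / τ) = Complex.exp (-(4 * Real.pi ^ 2 / s)) := by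
    rw [Function.Periodic.qParam, hτ']
    congr 1
    push_cast
    field_simp
    rw [Complex.I_sq]; ring
  have q4 : Function.Periodic.qParam 24 (-1 / τ) = Complex.exp (-(Real.pi ^ 2 / (6 * s))) := by
    rw [Function.Periodic.qParam, hτ']
    congr 1
    push_cast
    field_simp
    rw [Complex.I_sq]; ring
  rw [q1, q2] at e1
  rw [q3, q4, e3] at e2
  have e4 : Complex.sqrt (s / (2 * Real.pi)) * Complex.exp (-(s / 24)) *
      partitionGF (Complex.exp (-(4 * Real.pi ^ 2 / s))) =
      Complex.exp (-(Real.pi ^ 2 / (6 * s))) * partitionGF (Complex.exp (-s)) := by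
    rw [← e1, ← e2]; ring
  rw [sub_eq_add_neg, Complex.exp_add]
  have e5 : Complex.exp (Real.pi ^ 2 / (6 * s)) * Complex.exp (-(Real.pi ^ 2 / (6 * s))) = 1 := by
    rw [← Complex.exp_add]; simp
  linear_combination (-Complex.exp (Real.pi ^ 2 / (6 * s))) * e4 -
    partitionGF (Complex.exp (-s)) * e5

/-! ### Bound away from the positive real axis -/

/-- In the series of -log(1 - ‖w‖) + log ‖1 - w‖ every term (‖w‖^j - Re w^j)/j is nonnegative; keep
only j = 1. -/
lemma one_sub_norm_le_norm_one_sub_mul_exp {w : ℂ} (hw : ‖w‖ < 1) :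
    1 - ‖w‖ ≤ ‖1 - w‖ * Real.exp (w.re - ‖w‖) := by
  have h1 := Complex.hasSum_re (Complex.hasSum_taylorSeries_neg_log hw)
  have h2 := Complex.hasSum_re (Complex.hasSum_taylorSeries_neg_log (z := (‖w‖ : ℂ)) (by simpa using hw))
  have h3 := le_hasSum (h2.sub h1) 1 (fun j _ => by
    have e1 : ((‖w‖ : ℂ) ^ j / j).re = ‖w ^ j / j‖ := by
      rw [norm_div, norm_pow, Complex.norm_natCast]
      norm_cast
    rw [e1, sub_nonneg]
    exact Complex.re_le_norm _)
  have e2 : (1 : ℂ) - ‖w‖ = ((1 - ‖w‖ : ℝ) : ℂ) := by push_cast; rfl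
  simp only [pow_one, Nat.cast_one, div_one, Complex.ofReal_re, Complex.neg_re, Complex.log_re, e2,
    Complex.norm_real, Real.norm_eq_abs] at h3
  have hpos : 0 < 1 - ‖w‖ := by linarith
  have hpos' : 0 < ‖1 - w‖ := by
    have := norm_sub_norm_le (1 : ℂ) w
    simp at this
    linarith
  rw [abs_of_pos hpos] at h3
  rw [← Real.log_le_log_iff hpos (by positivity), Real.log_mul hpos'.ne' (Real.exp_pos _).ne',
    Real.log_exp]
  linarith

/-- Apply the previous bound to each factor of Euler's product; the gains add up to two geometric
series. -/
lemma norm_partitionGF_le {q : ℂ} (hq : ‖q‖ < 1) :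
    ‖partitionGF q‖ ≤ ‖partitionGF ‖q‖‖ * Real.exp (‖q‖ / ‖1 - q‖ - ‖q‖ / (1 - ‖q‖)) := by
  have hq' : ‖((‖q‖ : ℝ) : ℂ)‖ < 1 := by simpa using hq
  have hterm : ∀ N : ℕ, ‖(∏ i ∈ Finset.range N, (1 - q ^ (i + 1)))⁻¹‖ ≤
      ‖(∏ i ∈ Finset.range N, (1 - ((‖q‖ : ℝ) : ℂ) ^ (i + 1)))⁻¹‖ *
        Real.exp (∑ i ∈ Finset.range N, ((q ^ (i + 1)).re - ‖q‖ ^ (i + 1))) := by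
    intro N
    rw [Real.exp_sum, ← Finset.prod_inv_distrib, ← Finset.prod_inv_distrib, norm_prod, norm_prod,
      ← Finset.prod_mul_distrib]
    refine Finset.prod_le_prod (fun _ _ => norm_nonneg _) fun i _ => ?_
    have h1 : ‖q ^ (i + 1)‖ < 1 := by
      rw [norm_pow]; exact pow_lt_one₀ (norm_nonneg _) hq (by omega)
    have h2 := one_sub_norm_le_norm_one_sub_mul_exp h1
    have h3 : ‖(1 : ℂ) - ((‖q‖ : ℝ) : ℂ) ^ (i + 1)‖ = 1 - ‖q ^ (i + 1)‖ := by
      rw [norm_pow, ← Complex.ofReal_pow, ← Complex.ofReal_one, ← Complex.ofReal_sub,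
        Complex.norm_real, Real.norm_eq_abs, abs_of_pos]
      rw [norm_pow] at h1; linarith
    rw [norm_inv, norm_inv, h3, ← norm_pow, inv_mul_eq_div, le_div_iff₀ (by linarith),
      inv_mul_le_iff₀ (norm_pos_iff.2 (one_sub_pow_succ_ne_zero hq i))]
    exact h2
  have hs1 : HasSum (fun i : ℕ => (q ^ (i + 1)).re - ‖q‖ ^ (i + 1))
      ((q / (1 - q)).re - ‖q‖ / (1 - ‖q‖)) := by
    refine (Complex.hasSum_re ?_).sub ?_
    · simpa [pow_succ', div_eq_mul_inv] using (hasSum_geometric_of_norm_lt_one hq).mul_left q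
    · simpa [pow_succ', div_eq_mul_inv] using
        (hasSum_geometric_of_lt_one (norm_nonneg q) hq).mul_left ‖q‖
  refine (le_of_tendsto_of_tendsto' (tendsto_prod_inv hq).norm
    ((tendsto_prod_inv hq').norm.mul
      ((Real.continuous_exp.tendsto _).comp hs1.tendsto_sum_nat)) hterm).trans ?_
  change ‖partitionGF ‖q‖‖ * _ ≤ _
  gcongr
  exact (Complex.re_le_norm _).trans (by rw [norm_div])

/-! ### Cauchy's formula -/

lemma integral_exp_int_mul_I (k : ℤ) (hk : k ≠ 0) :
    ∫ y in (-Real.pi)..Real.pi, Complex.exp ((k * Complex.I) * (y : ℂ)) = 0 := by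
  have hc : (k * Complex.I : ℂ) ≠ 0 := mul_ne_zero (by exact_mod_cast hk) Complex.I_ne_zero
  rw [integral_exp_mul_complex hc, div_eq_zero_iff, sub_eq_zero]
  left
  rw [Complex.exp_eq_exp_iff_exists_int]
  refine ⟨k, ?_⟩
  push_cast
  ring

/-- Cauchy's formula for the number of partitions, on the circle of radius `exp (-x)`. -/
lemma two_pi_mul_partitionCount (n : ℕ) {x : ℝ} (hx : 0 < x) :
    ∫ y in (-Real.pi)..Real.pi, partitionGF (Complex.exp (-(x + y * Complex.I))) *
      Complex.exp (n * (x + y * Complex.I)) = 2 * Real.pi * partitionCount n := by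
  set F : ℕ → ℝ → ℂ := fun m y => (partitionCount m : ℂ) * Complex.exp (-(x + y * Complex.I)) ^ m *
      Complex.exp (n * (x + y * Complex.I)) with hF
  have hnorm : ∀ y : ℝ, ‖Complex.exp (-(x + y * Complex.I))‖ = Real.exp (-x) := by
    intro y; simp [Complex.norm_exp]
  have hlt : Real.exp (-x) < 1 := by simpa using hx
  have h := intervalIntegral.hasSum_integral_of_dominated_convergence (a := -Real.pi)
    (b := Real.pi) (μ := MeasureTheory.volume) (F := F)
    (f := fun y : ℝ => partitionGF (Complex.exp (-(x + y * Complex.I))) *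
      Complex.exp (n * (x + y * Complex.I)))
    (fun m _ => (partitionCount m : ℝ) * Real.exp (-x) ^ m * Real.exp (n * x))
    (fun m => by
      apply Continuous.aestronglyMeasurable
      simp only [hF]
      fun_prop)
    (fun m => Eventually.of_forall fun y _ => by
      simp only [hF]
      rw [norm_mul, norm_mul, norm_pow, hnorm, Complex.norm_natCast, Complex.norm_exp]
      simp)
    (Eventually.of_forall fun y _ =>
      (summable_partitionCount_real (Real.exp_pos _).le hlt).mul_right _)
    (by simp)
    (Eventually.of_forall fun y _ =>
      (hasSum_partitionCount (by rw [hnorm]; exact hlt)).mul_right _)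
  have hFe : ∀ m y, F m y = (partitionCount m * Complex.exp (((n - m : ℤ) : ℂ) * x)) *
      Complex.exp ((((n - m : ℤ) : ℂ) * Complex.I) * y) := by
    intro m y
    simp only [hF]
    rw [← Complex.exp_nat_mul, mul_assoc, mul_assoc, ← Complex.exp_add, ← Complex.exp_add]
    congr 2
    push_cast
    ring
  have hv : ∀ m, m ≠ n → ∫ y in (-Real.pi)..Real.pi, F m y = 0 := by
    intro m hm
    simp only [hFe]
    rw [intervalIntegral.integral_const_mul, integral_exp_int_mul_I _ (by omega), mul_zero]
  rw [← h.tsum_eq, tsum_eq_single n hv]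
  simp only [hFe]
  simp
  exact Or.inl (by ring)

/-! ### The integrand near and away from the saddle point -/

/-- The circle of radius `exp (-x)`, `x = π ^ 2 / (6 * A)`, in logarithmic coordinates, with the
angle rescaled to the width of the saddle point. -/
noncomputable def saddlePoint (A v : ℝ) : ℂ :=
  ((Real.pi ^ 2 / (6 * A) : ℝ) : ℂ) * (1 + ((v / √A : ℝ) : ℂ) * Complex.I)

/-- The integrand of Cauchy's formula for `p(n)`, `A = π √(n / 6)`, divided by its size at the
saddle point. -/
noncomputable def saddleIntegrand (A v : ℝ) : ℂ :=
  ((Real.exp (-2 * A) * (√(Real.pi / (12 * A)))⁻¹ : ℝ) : ℂ) *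
    (partitionGF (Complex.exp (-saddlePoint A v)) *
      Complex.exp (A * (1 + ((v / √A : ℝ) : ℂ) * Complex.I)))

lemma one_add_mul_I_ne_zero (u : ℝ) : (1 : ℂ) + u * Complex.I ≠ 0 := fun h => by
  simpa using congrArg Complex.re h

lemma inv_one_add_mul_I_re (u : ℝ) : ((1 : ℂ) + u * Complex.I)⁻¹.re = (1 + u ^ 2)⁻¹ := by
  rw [Complex.inv_re]
  simp [Complex.normSq_apply]
  have : 1 + u * u ≠ 0 := by nlinarith [mul_self_nonneg u]
  have : 1 + u ^ 2 ≠ 0 := by nlinarith [mul_self_nonneg u]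
  field_simp

lemma saddlePoint_re {A : ℝ} (v : ℝ) : (saddlePoint A v).re = Real.pi ^ 2 / (6 * A) := by
  rw [saddlePoint, Complex.re_ofReal_mul]
  simp

lemma Complex.sqrt_sq {z : ℂ} (hz : z ≠ 0) : Complex.sqrt z ^ 2 = z := by
  rw [_root_.sqrt_eq_exp hz, ← Complex.exp_nat_mul]
  convert! Complex.exp_log hz using 2
  push_cast
  ring

lemma Complex.sqrt_ofReal_mul {a : ℝ} (ha : 0 < a) {z : ℂ} (hz : z ≠ 0) :
    Complex.sqrt (a * z) = (√a : ℝ) * Complex.sqrt z := by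
  have ha' : (a : ℂ) ≠ 0 := by exact_mod_cast ha.ne'
  rw [_root_.sqrt_eq_exp (mul_ne_zero ha' hz), _root_.sqrt_eq_exp hz,
    Complex.log_ofReal_mul ha hz, add_div, Complex.exp_add]
  congr 1
  rw [← Complex.ofReal_ofNat, ← Complex.ofReal_div, ← Complex.ofReal_exp, Real.sqrt_eq_rpow,
    Real.rpow_def_of_pos ha]
  congr 3
  ring

/-- With z = 1 + iv/√A the modular transformation contributes A/z and the Cauchy kernel Az. The
Gaussian is Az + A/z - 2A = A(z-1)²/z = -v²/z. -/
lemma saddleIntegrand_eq {A : ℝ} (hA : 0 < A) (v : ℝ) :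
    saddleIntegrand A v = Complex.sqrt (1 + ((v / √A : ℝ) : ℂ) * Complex.I) *
      Complex.exp (-((v : ℂ) ^ 2 / (1 + ((v / √A : ℝ) : ℂ) * Complex.I))) *
      Complex.exp (-(saddlePoint A v / 24)) *
      partitionGF (Complex.exp (-(24 * A / (1 + ((v / √A : ℝ) : ℂ) * Complex.I)))) := by
  have hre : 0 < (saddlePoint A v).re := by rw [saddlePoint_re]; positivity
  have hpi : (Real.pi : ℂ) ≠ 0 := by exact_mod_cast Real.pi_ne_zero
  have hAc : (A : ℂ) ≠ 0 := by exact_mod_cast hA.ne'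
  have hv : (v : ℂ) ^ 2 = A * ((v / √A : ℝ) : ℂ) ^ 2 := by
    norm_cast
    rw [div_pow, Real.sq_sqrt hA.le]
    field_simp
  rw [saddleIntegrand, partitionGF_exp_neg hre, hv]
  have hz := one_add_mul_I_ne_zero (v / √A)
  set z : ℂ := 1 + ((v / √A : ℝ) : ℂ) * Complex.I with hzdef
  have hu : ((v / √A : ℝ) : ℂ) ^ 2 = -(z - 1) ^ 2 := by
    rw [hzdef, add_sub_cancel_left, mul_pow, Complex.I_sq]; ring
  rw [hu]
  have hs : saddlePoint A v = (Real.pi ^ 2 / (6 * A)) * z := by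
    rw [saddlePoint, ← hzdef]; push_cast; rfl
  have e1 : saddlePoint A v / (2 * Real.pi) = ((Real.pi / (12 * A) : ℝ) : ℂ) * z := by
    rw [hs]; push_cast; field_simp; ring
  have e2 : 4 * (Real.pi : ℂ) ^ 2 / saddlePoint A v = 24 * A / z := by
    rw [hs]; field_simp; ring
  have e3 : (Real.pi : ℂ) ^ 2 / (6 * saddlePoint A v) = A / z := by
    rw [hs]; field_simp
  have hsq : 0 < √(Real.pi / (12 * A)) := by positivity
  rw [e1, e2, e3, Complex.sqrt_ofReal_mul (by positivity) hz]
  have e4 : ((Real.exp (-2 * A) * (√(Real.pi / (12 * A)))⁻¹ : ℝ) : ℂ) =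
      Complex.exp (-2 * A) * ((√(Real.pi / (12 * A)) : ℝ) : ℂ)⁻¹ := by push_cast; rfl
  have hsq' : ((√(Real.pi / (12 * A)) : ℝ) : ℂ) ≠ 0 := by exact_mod_cast hsq.ne'
  have e5 : Complex.exp (-2 * A) * Complex.exp (A / z - saddlePoint A v / 24) * Complex.exp (A * z) =
      Complex.exp (-(A * -(z - 1) ^ 2 / z)) * Complex.exp (-(saddlePoint A v / 24)) := by
    rw [← Complex.exp_add, ← Complex.exp_add, ← Complex.exp_add]
    congr 1
    field_simp
    ring
  rw [e4]
  calc _ = (((√(Real.pi / (12 * A)) : ℝ) : ℂ)⁻¹ * ((√(Real.pi / (12 * A)) : ℝ) : ℂ)) *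
        Complex.sqrt z * (Complex.exp (-2 * A) * Complex.exp (A / z - saddlePoint A v / 24) *
          Complex.exp (A * z)) * partitionGF (Complex.exp (-(24 * A / z))) := by ring
    _ = _ := by rw [inv_mul_cancel₀ hsq', e5]; ring

lemma norm_exp_neg_div_one_add_mul_I (a u : ℝ) :
    ‖Complex.exp (-((a : ℂ) / (1 + (u : ℂ) * Complex.I)))‖ = Real.exp (-(a / (1 + u ^ 2))) := by
  rw [Complex.norm_exp, Complex.neg_re, div_eq_mul_inv, Complex.re_ofReal_mul,
    inv_one_add_mul_I_re, div_eq_mul_inv]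

/-- Close to `0`, the generating function of partitions is bounded by `2`. -/
lemma eventually_norm_partitionGF_le_two :
    ∀ᶠ A : ℝ in atTop, ∀ q : ℂ, ‖q‖ ≤ Real.exp (-A) → ‖partitionGF q‖ ≤ 2 := by
  have h := tendsto_partitionGF_zero.norm.eventually (eventually_le_nhds (b := 2) (by simp))
  rw [Metric.eventually_nhds_iff] at h
  obtain ⟨ε, hε, h⟩ := h
  have h2 : ∀ᶠ A : ℝ in atTop, Real.exp (-A) < ε :=
    (Real.tendsto_exp_neg_atTop_nhds_zero).eventually (eventually_lt_nhds hε)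
  filter_upwards [h2] with A hA q hq
  exact h (by simpa using hq.trans_lt hA)

lemma tendsto_saddleIntegrand (v : ℝ) :
    Tendsto (fun A => saddleIntegrand A v) atTop (𝓝 ((Real.exp (-v ^ 2) : ℝ) : ℂ)) := by
  have hu : Tendsto (fun A : ℝ => ((v / √A : ℝ) : ℂ)) atTop (𝓝 0) := by
    rw [← Complex.ofReal_zero]
    exact (Complex.continuous_ofReal.tendsto _).comp
      (tendsto_const_nhds.div_atTop Real.tendsto_sqrt_atTop)
  have hz : Tendsto (fun A : ℝ => 1 + ((v / √A : ℝ) : ℂ) * Complex.I) atTop (𝓝 1) := by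
    simpa using (hu.mul_const Complex.I).const_add 1
  have h1 : Tendsto (fun A : ℝ => Complex.sqrt (1 + ((v / √A : ℝ) : ℂ) * Complex.I)) atTop
      (𝓝 1) := by
    have := (Complex.differentiableAt_sqrt (z := 1) (by simp)).continuousAt.tendsto.comp hz
    rw [Complex.sqrt_one] at this
    exact this
  have h2 : Tendsto (fun A : ℝ => Complex.exp (-((v : ℂ) ^ 2 /
      (1 + ((v / √A : ℝ) : ℂ) * Complex.I)))) atTop (𝓝 (Complex.exp (-((v : ℂ) ^ 2 / 1)))) :=
    (Complex.continuous_exp.tendsto _).comp (tendsto_const_nhds.div hz one_ne_zero).neg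
  have h3 : Tendsto (fun A : ℝ => Complex.exp (-(saddlePoint A v / 24))) atTop (𝓝 1) := by
    have hx : Tendsto (fun A : ℝ => ((Real.pi ^ 2 / (6 * A) : ℝ) : ℂ)) atTop (𝓝 0) := by
      rw [← Complex.ofReal_zero]
      exact (Complex.continuous_ofReal.tendsto _).comp
        (tendsto_const_nhds.div_atTop (tendsto_id.const_mul_atTop (by norm_num)))
    have := (Complex.continuous_exp.tendsto _).comp ((hx.mul hz).div_const 24).neg
    simp only [zero_mul, zero_div, neg_zero, Complex.exp_zero] at this
    exact this
  have h4 : Tendsto (fun A : ℝ => partitionGF (Complex.exp (-(24 * A /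
      (1 + ((v / √A : ℝ) : ℂ) * Complex.I))))) atTop (𝓝 1) := by
    refine tendsto_partitionGF_zero.comp ?_
    rw [tendsto_zero_iff_norm_tendsto_zero]
    have hu' : Tendsto (fun A : ℝ => v / √A) atTop (𝓝 0) :=
      tendsto_const_nhds.div_atTop Real.tendsto_sqrt_atTop
    have hd : Tendsto (fun A : ℝ => (1 + (v / √A) ^ 2)⁻¹) atTop (𝓝 1) := by
      simpa using ((hu'.pow 2).const_add 1).inv₀ (by norm_num)
    have h5 : Tendsto (fun A : ℝ => 24 * A / (1 + (v / √A) ^ 2)) atTop atTop := by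
      exact (tendsto_id.const_mul_atTop (by norm_num : (0 : ℝ) < 24)).atTop_mul_pos one_pos hd
    refine (Real.tendsto_exp_neg_atTop_nhds_zero.comp h5).congr fun A => ?_
    refine (norm_exp_neg_div_one_add_mul_I _ _).symm.trans ?_
    push_cast
    rfl
  have h := ((h1.mul h2).mul h3).mul h4
  have e : (1 : ℂ) * Complex.exp (-((v : ℂ) ^ 2 / 1)) * 1 * 1 =
      ((Real.exp (-v ^ 2) : ℝ) : ℂ) := by push_cast; simp
  rw [e] at h
  refine h.congr' ?_
  filter_upwards [eventually_gt_atTop 0] with A hA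
  exact (saddleIntegrand_eq hA v).symm

lemma exp_neg_half_sq_le (v : ℝ) : Real.exp (-(v ^ 2 / 2)) ≤ 2 * (1 + v ^ 2)⁻¹ := by
  have h := Real.add_one_le_exp (v ^ 2 / 2)
  rw [Real.exp_neg, ← div_eq_mul_inv, le_div_iff₀ (by positivity), inv_mul_le_iff₀ (by positivity)]
  nlinarith [sq_nonneg v]

/-- Here |v/√A| ≤ 1, so 1/z has real part at least 1/2: the Gaussian factor is at most e^(-v²/2) and
the argument of the last factor at most e^(-12A). -/
lemma eventually_norm_saddleIntegrand_le_of_sq_le :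
    ∀ᶠ A : ℝ in atTop, ∀ v : ℝ, v ^ 2 ≤ A → ‖saddleIntegrand A v‖ ≤ 8 * (1 + v ^ 2)⁻¹ := by
  filter_upwards [eventually_norm_partitionGF_le_two, eventually_gt_atTop 0] with A hF hA v hv
  have hu : (v / √A) ^ 2 ≤ 1 := by
    rw [div_pow, Real.sq_sqrt hA.le]
    exact (div_le_one hA).2 hv
  rw [saddleIntegrand_eq hA, norm_mul, norm_mul, norm_mul]
  have h1 : ‖Complex.sqrt (1 + ((v / √A : ℝ) : ℂ) * Complex.I)‖ ≤ 2 := by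
    have h := congrArg norm (Complex.sqrt_sq (one_add_mul_I_ne_zero (v / √A)))
    rw [norm_pow] at h
    have h2 : ‖(1 : ℂ) + ((v / √A : ℝ) : ℂ) * Complex.I‖ ≤ 2 := by
      refine (norm_add_le _ _).trans ?_
      rw [norm_mul, Complex.norm_I, norm_one, mul_one, Complex.norm_real, Real.norm_eq_abs]
      linarith [(sq_le_one_iff_abs_le_one _).1 hu]
    nlinarith [norm_nonneg (Complex.sqrt (1 + ((v / √A : ℝ) : ℂ) * Complex.I))]
  have h2 : ‖Complex.exp (-((v : ℂ) ^ 2 / (1 + ((v / √A : ℝ) : ℂ) * Complex.I)))‖ ≤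
      2 * (1 + v ^ 2)⁻¹ := by
    refine le_trans ?_ (exp_neg_half_sq_le v)
    rw [← Complex.ofReal_pow, norm_exp_neg_div_one_add_mul_I]
    gcongr
    linarith
  have h3 : ‖Complex.exp (-(saddlePoint A v / 24))‖ ≤ 1 := by
    rw [Complex.norm_exp, Real.exp_le_one_iff, Complex.neg_re, ← Complex.ofReal_ofNat,
      Complex.div_ofReal_re, saddlePoint_re]
    have : 0 ≤ Real.pi ^ 2 / (6 * A) / 24 := by positivity
    linarith
  have h4 : ‖partitionGF (Complex.exp (-(24 * A / (1 + ((v / √A : ℝ) : ℂ) * Complex.I))))‖ ≤ 2 := by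
    apply hF
    have e : (24 * A : ℂ) = ((24 * A : ℝ) : ℂ) := by push_cast; rfl
    rw [e, norm_exp_neg_div_one_add_mul_I]
    gcongr
    rw [le_div_iff₀ (by positivity)]
    nlinarith
  calc _ ≤ 2 * (2 * (1 + v ^ 2)⁻¹) * 1 * 2 := by gcongr
    _ = _ := by ring

/-- Off the real axis, `1 - q` is noticeably larger than `1 - |q|`. -/
lemma norm_one_sub_exp_neg_ge {x u : ℝ} (hx : 0 < x) (hx2 : x ≤ 1 / 2) (hu : 1 ≤ u ^ 2)
    (hu2 : |x * u| ≤ Real.pi) :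
    12 / 11 * (1 - Real.exp (-x)) ≤ ‖1 - Complex.exp (-((x : ℂ) * (1 + u * Complex.I)))‖ := by
  have hr : 1 - x ≤ Real.exp (-x) := by linarith [Real.add_one_le_exp (-x)]
  have hr1 : Real.exp (-x) < 1 := by simpa using hx
  set r := Real.exp (-x) with hrdef
  have hcos := Real.cos_le_one_sub_mul_cos_sq hu2
  have hq : Complex.exp (-((x : ℂ) * (1 + u * Complex.I))) =
      ((r * Real.cos (x * u) : ℝ) : ℂ) - ((r * Real.sin (x * u) : ℝ) : ℂ) * Complex.I := by
    have : -((x : ℂ) * (1 + u * Complex.I)) = ((-x : ℝ) : ℂ) + ((-(x * u) : ℝ) : ℂ) * Complex.I := by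
      push_cast; ring
    rw [this, Complex.exp_add, Complex.exp_mul_I, ← Complex.ofReal_exp, ← Complex.ofReal_cos,
      ← Complex.ofReal_sin, Real.cos_neg, Real.sin_neg, hrdef]
    push_cast
    ring
  have hn : ‖1 - Complex.exp (-((x : ℂ) * (1 + u * Complex.I)))‖ ^ 2 =
      (1 - r) ^ 2 + 2 * r * (1 - Real.cos (x * u)) := by
    have hab : ∀ a b : ℝ, Complex.normSq (1 - ((a : ℂ) - (b : ℂ) * Complex.I)) =
        (1 - a) ^ 2 + b ^ 2 := by
      intro a b; simp [Complex.normSq_apply]; ring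
    rw [← Complex.normSq_eq_norm_sq, hq, hab]
    nlinarith [Real.sin_sq_add_cos_sq (x * u)]
  have hpi : Real.pi ^ 2 ≤ 10 := by nlinarith [Real.pi_lt_d2, Real.pi_pos]
  have h1 : (1 : ℝ) / 5 * x ^ 2 ≤ 1 - Real.cos (x * u) := by
    have h2 : (1 : ℝ) / 5 ≤ 2 / Real.pi ^ 2 := by
      rw [div_le_div_iff₀ (by norm_num) (by positivity)]; linarith
    have h3 : x ^ 2 ≤ (x * u) ^ 2 := by rw [mul_pow]; nlinarith [sq_nonneg x]
    have h4 := mul_le_mul h2 h3 (sq_nonneg x) (by positivity)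
    linarith
  -- As r ≥ 1/2, 2r(1 - cos) ≥ x²/5 ≥ (1-r)²/5, and (12/11)² < 6/5.
  refine le_of_sq_le_sq ?_ (norm_nonneg _)
  rw [hn]
  have h5 : (1 - r) ^ 2 ≤ x ^ 2 := by
    apply pow_le_pow_left₀ <;> linarith
  nlinarith [mul_le_mul (show (1 : ℝ) / 2 ≤ r by linarith) h1 (by positivity) (by linarith)]

/-- The integrand is at most e^(-A/40) times its size at v = 0, while v² grows only like A³; hence
the same majorant still serves. -/
lemma eventually_norm_saddleIntegrand_le_of_lt_sq :
    ∀ᶠ A : ℝ in atTop, ∀ v : ℝ, A < v ^ 2 → |v| ≤ Real.pi * (6 * A * √A / Real.pi ^ 2) →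
      ‖saddleIntegrand A v‖ ≤ 8 * (1 + v ^ 2)⁻¹ := by
  have hlim : ∀ᶠ A : ℝ in atTop, Real.exp (-(A / 40)) * (1 + 4 * A ^ 3) ≤ 4 := by
    have h0 : Tendsto (fun A : ℝ => A / 40) atTop atTop := tendsto_id.atTop_div_const (by norm_num)
    have h1 := (Real.tendsto_pow_mul_exp_neg_atTop_nhds_zero 3).comp h0
    have h2 := (Real.tendsto_pow_mul_exp_neg_atTop_nhds_zero 0).comp h0
    have h3 := h2.add (h1.const_mul (4 * 40 ^ 3))
    simp only [Function.comp_def, mul_zero, add_zero, pow_zero, one_mul] at h3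
    filter_upwards [h3.eventually (eventually_le_nhds (b := 4) (by norm_num))] with A hA
    refine le_trans (le_of_eq ?_) hA
    ring
  filter_upwards [eventually_norm_partitionGF_le_two, eventually_ge_atTop 10, hlim]
    with A hF hA10 hAlim v hv hv2
  have hA : 0 < A := by linarith
  have hpi : Real.pi ^ 2 ≤ 10 := by nlinarith [Real.pi_lt_d2, Real.pi_pos]
  have hpi9 : 9 ≤ Real.pi ^ 2 := by nlinarith [Real.pi_gt_three]
  have hsA : 0 < √A := by positivity
  set x := Real.pi ^ 2 / (6 * A) with hx
  have hx0 : 0 < x := by positivity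
  have hx2 : x ≤ 1 / 2 := by
    rw [hx, div_le_div_iff₀ (by positivity) (by norm_num)]; linarith
  have hu : 1 ≤ (v / √A) ^ 2 := by
    rw [div_pow, Real.sq_sqrt hA.le, le_div_iff₀ hA]; linarith
  have hxu : |x * (v / √A)| ≤ Real.pi := by
    rw [abs_mul x, abs_div v, abs_of_pos hx0, abs_of_pos hsA, mul_div_assoc', div_le_iff₀ hsA]
    calc x * |v| ≤ x * (Real.pi * (6 * A * √A / Real.pi ^ 2)) := by gcongr
      _ = Real.pi * √A := by rw [hx]; field_simp
  have hgap := norm_one_sub_exp_neg_ge hx0 hx2 hu hxu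
  have hs : saddlePoint A v = (x : ℂ) * (1 + ((v / √A : ℝ) : ℂ) * Complex.I) := rfl
  have hnq : ‖Complex.exp (-saddlePoint A v)‖ = Real.exp (-x) := by
    rw [Complex.norm_exp, Complex.neg_re, saddlePoint_re]
  have hr1 : Real.exp (-x) < 1 := by simpa using hx0
  have hr : 1 - x ≤ Real.exp (-x) := by linarith [Real.add_one_le_exp (-x)]
  have hmin := norm_partitionGF_le (q := Complex.exp (-saddlePoint A v)) (by rw [hnq]; exact hr1)
  rw [hnq] at hmin
  rw [← hs] at hgap
  -- the value at the saddle point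
  have h0 : ‖saddleIntegrand A 0‖ ≤ 2 := by
    rw [saddleIntegrand_eq hA]
    simp only [zero_div, Complex.ofReal_zero, zero_mul, add_zero, Complex.sqrt_one, one_mul, ne_eq,
      OfNat.ofNat_ne_zero, not_false_eq_true, zero_pow, neg_zero, Complex.exp_zero, div_one,
      norm_mul]
    have h3 : ‖Complex.exp (-(saddlePoint A 0 / 24))‖ ≤ 1 := by
      rw [Complex.norm_exp, Real.exp_le_one_iff, Complex.neg_re, ← Complex.ofReal_ofNat,
        Complex.div_ofReal_re, saddlePoint_re, ← hx]
      linarith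
    have h4 := hF (Complex.exp (-(24 * A))) (by
      rw [Complex.norm_exp]; simp; linarith)
    calc _ ≤ 1 * (2 : ℝ) := by gcongr
      _ = 2 := by norm_num
  -- The factor 12/11 saves one twelfth of r/(1-r) ≥ 1/(2x) = 3A/π² ≥ 3A/10, that is, at least A/40.
  have hexp : Real.exp (-x) / ‖1 - Complex.exp (-saddlePoint A v)‖ -
      Real.exp (-x) / (1 - Real.exp (-x)) ≤ -(A / 40) := by
    set r := Real.exp (-x)
    have hr1' : 0 < 1 - r := by linarith
    have e1 : r / ‖1 - Complex.exp (-saddlePoint A v)‖ ≤ r / (12 / 11 * (1 - r)) := by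
      have : 0 < r := Real.exp_pos _
      gcongr
    have e2 : r / (12 / 11 * (1 - r)) - r / (1 - r) = -(1 / 12 * (r / (1 - r))) := by
      field_simp; ring
    have e3 : 1 / 2 / x ≤ r / (1 - r) := by
      have : 0 < r := Real.exp_pos _
      gcongr <;> linarith
    have e4 : 3 * A / 10 ≤ 1 / 2 / x := by
      rw [hx, le_div_iff₀ (by positivity)]
      rw [mul_div_assoc', div_le_iff₀ (by positivity)]
      nlinarith
    linarith
  have hfac : ‖saddleIntegrand A v‖ ≤ ‖saddleIntegrand A 0‖ * Real.exp (-(A / 40)) := by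
    have hs0 : saddlePoint A 0 = (x : ℂ) := by simp [saddlePoint, hx]
    have hE : ∀ w : ℝ, ‖Complex.exp (A * (1 + ((w / √A : ℝ) : ℂ) * Complex.I))‖ = Real.exp A := by
      intro w
      rw [Complex.norm_exp, Complex.re_ofReal_mul]
      simp
    rw [saddleIntegrand, saddleIntegrand, norm_mul, norm_mul, norm_mul, norm_mul, hE, hE, hs0]
    have e : Complex.exp (-(x : ℂ)) = ((Real.exp (-x) : ℝ) : ℂ) := by push_cast; rfl
    rw [e, mul_assoc, mul_right_comm ‖partitionGF _‖]
    gcongr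
    exact hmin.trans (by gcongr)
  have hv3 : v ^ 2 ≤ 4 * A ^ 3 := by
    have h1 : |v| ^ 2 ≤ (Real.pi * (6 * A * √A / Real.pi ^ 2)) ^ 2 := by gcongr
    rw [sq_abs] at h1
    have h2 : (Real.pi * (6 * A * √A / Real.pi ^ 2)) ^ 2 = 36 * A ^ 3 / Real.pi ^ 2 := by
      have := Real.sq_sqrt hA.le
      field_simp
      rw [this]; ring
    rw [h2] at h1
    refine h1.trans ?_
    rw [div_le_iff₀ (by positivity)]
    have : 0 < A ^ 3 := by positivity
    nlinarith
  rw [← div_eq_mul_inv, le_div_iff₀ (by positivity)]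
  calc ‖saddleIntegrand A v‖ * (1 + v ^ 2)
      ≤ (2 * Real.exp (-(A / 40))) * (1 + 4 * A ^ 3) := by
        refine mul_le_mul (hfac.trans ?_) (by linarith) (by positivity) (by positivity)
        gcongr
    _ ≤ 8 := by linarith

/-! ### The Hardy–Ramanujan formula -/

/-- The scaled range `|y| ≤ π` of integration in Cauchy's formula. -/
noncomputable def saddleRange (A : ℝ) : ℝ := Real.pi * (6 * A * √A / Real.pi ^ 2)

lemma continuous_saddleIntegrand {A : ℝ} (hA : 0 < A) : Continuous (saddleIntegrand A) := by
  have h1 : Continuous (saddlePoint A) := by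
    unfold saddlePoint
    fun_prop
  have h2 : Continuous fun v => partitionGF (Complex.exp (-saddlePoint A v)) := by
    refine continuousOn_partitionGF.comp_continuous (by fun_prop) fun v => ?_
    rw [mem_ball_zero_iff, Complex.norm_exp, Complex.neg_re, saddlePoint_re, Real.exp_lt_one_iff,
      neg_lt_zero]
    positivity
  unfold saddleIntegrand
  fun_prop

/-- Dominated convergence on the whole line, after cutting off by the indicator of the growing
interval; the limit is the Gaussian integral. -/
lemma tendsto_integral_saddleIntegrand :
    Tendsto (fun A => ∫ v in -saddleRange A..saddleRange A, saddleIntegrand A v) atTop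
      (𝓝 ((√Real.pi : ℝ) : ℂ)) := by
  have hg : ∫ v : ℝ, ((Real.exp (-v ^ 2) : ℝ) : ℂ) = ((√Real.pi : ℝ) : ℂ) := by
    rw [integral_complex_ofReal]
    congr 1
    simpa using integral_gaussian 1
  have hR : Tendsto saddleRange atTop atTop := by
    have : saddleRange = fun A => (6 / Real.pi) * (A * √A) := by
      funext A; rw [saddleRange]; field_simp
    rw [this]
    exact (tendsto_id.atTop_mul_atTop₀ Real.tendsto_sqrt_atTop).const_mul_atTop (by positivity)
  rw [← hg]
  have hbound : ∀ᶠ A : ℝ in atTop, ∀ v : ℝ, |v| ≤ saddleRange A →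
      ‖saddleIntegrand A v‖ ≤ 8 * (1 + v ^ 2)⁻¹ := by
    filter_upwards [eventually_norm_saddleIntegrand_le_of_sq_le,
      eventually_norm_saddleIntegrand_le_of_lt_sq] with A h1 h2 v hv
    rcases le_or_gt (v ^ 2) A with h | h
    · exact h1 v h
    · exact h2 v h hv
  have hD := MeasureTheory.tendsto_integral_filter_of_dominated_convergence
    (μ := MeasureTheory.volume) (l := atTop)
    (F := fun A : ℝ => (Set.Ioc (-saddleRange A) (saddleRange A)).indicator (saddleIntegrand A))
    (f := fun v : ℝ => ((Real.exp (-v ^ 2) : ℝ) : ℂ)) (fun v => 8 * (1 + v ^ 2)⁻¹) ?_ ?_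
    (integrable_inv_one_add_sq.const_mul 8) ?_
  · refine hD.congr' ?_
    filter_upwards [hR.eventually_ge_atTop 0] with A hA
    rw [MeasureTheory.integral_indicator measurableSet_Ioc,
      intervalIntegral.integral_of_le (by linarith)]
  · filter_upwards [eventually_gt_atTop 0] with A hA
    exact (continuous_saddleIntegrand hA).aestronglyMeasurable.indicator measurableSet_Ioc
  · filter_upwards [hbound] with A hA
    refine Eventually.of_forall fun v => ?_
    by_cases hv : v ∈ Set.Ioc (-saddleRange A) (saddleRange A)
    · rw [Set.indicator_of_mem hv]
      exact hA v (abs_le.2 ⟨hv.1.le, hv.2⟩)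
    · rw [Set.indicator_of_notMem hv, norm_zero]
      positivity
  · refine Eventually.of_forall fun v => (tendsto_saddleIntegrand v).congr' ?_
    filter_upwards [hR.eventually_gt_atTop |v|] with A hA
    have := abs_lt.1 hA
    rw [Set.indicator_of_mem (show v ∈ Set.Ioc _ _ from ⟨this.1, this.2.le⟩)]

/-- Substitute y = (x/√A)v in Cauchy's formula; the choice of A makes nx = A. -/
lemma integral_saddleIntegrand (n : ℕ) (hn : 0 < n) :
    ∫ v in -saddleRange (Real.pi * √(n / 6))..saddleRange (Real.pi * √(n / 6)),
      saddleIntegrand (Real.pi * √(n / 6)) v =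
    ((√Real.pi * (partitionCount n *
      (4 * n * √3 * Real.exp (-(2 * Real.pi * √(n / 6))))) : ℝ) : ℂ) := by
  have hn' : (0 : ℝ) < n := by exact_mod_cast hn
  set A := Real.pi * √(n / 6) with hAdef
  have hA : 0 < A := by positivity
  have hnA : (n : ℝ) = 6 * A ^ 2 / Real.pi ^ 2 := by
    rw [hAdef, mul_pow, Real.sq_sqrt (by positivity)]
    field_simp
  have hsA : 0 < √A := by positivity
  set x := Real.pi ^ 2 / (6 * A) with hx
  have hx0 : 0 < x := by positivity
  have hnx : (n : ℝ) * x = A := by rw [hnA, hx]; field_simp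
  set g : ℝ → ℂ := fun y => partitionGF (Complex.exp (-(x + y * Complex.I))) *
      Complex.exp (n * (x + y * Complex.I)) with hg
  have h1 : ∀ v, saddleIntegrand A v =
      ((Real.exp (-2 * A) * (√(Real.pi / (12 * A)))⁻¹ : ℝ) : ℂ) * g (x / √A * v) := by
    intro v
    have e1 : saddlePoint A v = x + ((x / √A * v : ℝ) : ℂ) * Complex.I := by
      rw [saddlePoint, ← hx]; push_cast; ring
    have e2 : (A : ℂ) * (1 + ((v / √A : ℝ) : ℂ) * Complex.I) =
        n * (x + ((x / √A * v : ℝ) : ℂ) * Complex.I) := by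
      rw [← hnx]; push_cast; ring
    rw [saddleIntegrand, e1, e2]
  simp only [h1]
  have hc : x / √A ≠ 0 := by positivity
  have hend : x / √A * saddleRange A = Real.pi := by
    rw [saddleRange, hx]; field_simp
  rw [intervalIntegral.integral_const_mul, intervalIntegral.integral_comp_mul_left g hc, mul_neg,
    hend, hg, two_pi_mul_partitionCount n hx0, Complex.real_smul]
  have hfin : Real.exp (-2 * A) * (√(Real.pi / (12 * A)))⁻¹ * ((x / √A)⁻¹ *
      (2 * Real.pi * partitionCount n)) = √Real.pi * (partitionCount n *
      (4 * n * √3 * Real.exp (-(2 * A)))) := by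
    have e1 : √(Real.pi / (12 * A)) = √Real.pi / (2 * √3 * √A) := by
      rw [Real.sqrt_div Real.pi_pos.le, show 12 * A = 2 ^ 2 * 3 * A by ring,
        Real.sqrt_mul (by positivity), Real.sqrt_mul (by positivity), Real.sqrt_sq (by norm_num)]
    have e2 : -2 * A = -(2 * A) := by ring
    have e3 : √A ^ 2 = A := Real.sq_sqrt hA.le
    have e4 : √Real.pi ^ 2 = Real.pi := Real.sq_sqrt Real.pi_pos.le
    have e5 : 0 < √Real.pi := by positivity
    rw [e1, e2, hnA, hx]
    field_simp
    rw [e3, e4]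
    ring
  rw [show 2 * Real.pi * √((n : ℝ) / 6) = 2 * A by rw [hAdef]; ring, ← hfin]
  push_cast
  ring

/-- The Hardy–Ramanujan asymptotic formula, as a limit. -/
lemma tendsto_partitionCount_mul :
    Tendsto (fun n : ℕ => (partitionCount n : ℝ) *
      (4 * n * √3 * Real.exp (-(2 * Real.pi * √(n / 6))))) atTop (𝓝 1) := by
  have hA : Tendsto (fun n : ℕ => Real.pi * √((n : ℝ) / 6)) atTop atTop :=
    (Real.tendsto_sqrt_atTop.comp
      (tendsto_natCast_atTop_atTop.atTop_div_const (by norm_num))).const_mul_atTop Real.pi_pos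
  have h := tendsto_integral_saddleIntegrand.comp hA
  have h2 := (Complex.continuous_re.tendsto _).comp h
  have h3 := h2.const_mul (√Real.pi)⁻¹
  have hpi : √Real.pi ≠ 0 := by positivity
  rw [Complex.ofReal_re, inv_mul_cancel₀ hpi] at h3
  refine h3.congr' ?_
  filter_upwards [eventually_gt_atTop 0] with n hn
  simp only [Function.comp_apply]
  rw [integral_saddleIntegrand n hn, Complex.ofReal_re, inv_mul_cancel_left₀ hpi]

/-- The Hardy–Ramanujan asymptotic formula. -/
theorem isEquivalent_partitionCount :
    (fun n : ℕ => (partitionCount n : ℝ)) ~[atTop]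
      (fun n : ℕ => 1 / (4 * (n : ℝ) * √3) * Real.exp (2 * Real.pi * √((n : ℝ) / 6))) := by
  refine (isEquivalent_iff_tendsto_one ?_).2 ?_
  · filter_upwards [eventually_gt_atTop 0] with n hn
    positivity
  · refine tendsto_partitionCount_mul.congr fun n => ?_
    rw [Pi.div_apply, Real.exp_neg]
    field_simp

/-! ### Equidistribution -/

lemma tendsto_sqrt_add_two_sub : Tendsto (fun n : ℕ => √(((n + 2 : ℕ) : ℝ) / 6) - √((n : ℝ) / 6))
    atTop (𝓝 0) := by
  -- The squares of the two roots differ by 1/3.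
  have h1 : Tendsto (fun n : ℕ => (1 / 3 : ℝ) / √((n : ℝ) / 6)) atTop (𝓝 0) :=
    tendsto_const_nhds.div_atTop (Real.tendsto_sqrt_atTop.comp
      (tendsto_natCast_atTop_atTop.atTop_div_const (by norm_num)))
  refine tendsto_of_tendsto_of_tendsto_of_le_of_le' tendsto_const_nhds h1
    (Eventually.of_forall fun n => ?_) ?_
  · rw [sub_nonneg]
    gcongr
    omega
  · filter_upwards [eventually_gt_atTop 0] with n hn
    have hn' : (0 : ℝ) < n := by exact_mod_cast hn
    have h0 : 0 < √((n : ℝ) / 6) := by positivity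
    have h2 : √((n : ℝ) / 6) ≤ √(((n + 2 : ℕ) : ℝ) / 6) := by gcongr; omega
    rw [le_div_iff₀ h0]
    have e1 := Real.sq_sqrt (show (0 : ℝ) ≤ (n : ℝ) / 6 by positivity)
    have e2 := Real.sq_sqrt (show (0 : ℝ) ≤ ((n + 2 : ℕ) : ℝ) / 6 by positivity)
    push_cast at *
    nlinarith

lemma tendsto_partitionCount_div_add_two :
    Tendsto (fun n : ℕ => (partitionCount n : ℝ) / partitionCount (n + 2)) atTop (𝓝 1) := by
  have h1 := tendsto_partitionCount_mul
  have h2 := h1.comp (tendsto_add_atTop_nat 2)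
  have h3 : Tendsto (fun n : ℕ => Real.exp (-(2 * Real.pi * (√(((n + 2 : ℕ) : ℝ) / 6) -
      √((n : ℝ) / 6))))) atTop (𝓝 1) := by
    have := (Real.continuous_exp.tendsto _).comp
      (tendsto_sqrt_add_two_sub.const_mul (2 * Real.pi)).neg
    simpa using! this
  have h4 : Tendsto (fun n : ℕ => ((n + 2 : ℕ) : ℝ) / n) atTop (𝓝 1) := by
    have := (tendsto_const_div_atTop_nhds_zero_nat 2).const_add (1 : ℝ)
    rw [add_zero] at this
    refine this.congr' ?_
    filter_upwards [eventually_gt_atTop 0] with n hn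
    have hn' : (n : ℝ) ≠ 0 := by exact_mod_cast hn.ne'
    push_cast
    field_simp
  have h5 := ((h1.div h2 one_ne_zero).mul h3).mul h4
  simp only [div_one, mul_one] at h5
  refine h5.congr' ?_
  filter_upwards [eventually_gt_atTop 0] with n hn
  have hn' : (n : ℝ) ≠ 0 := by exact_mod_cast hn.ne'
  simp only [Pi.div_apply, Function.comp_apply]
  rw [mul_sub, neg_sub, Real.exp_sub, Real.exp_neg, Real.exp_neg]
  have : ((n + 2 : ℕ) : ℝ) ≠ 0 := by positivity
  field_simp

/-- Disposes of the stray 1 in the comparison of rank classes. -/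
lemma tendsto_inv_partitionCount :
    Tendsto (fun n : ℕ => (partitionCount n : ℝ)⁻¹) atTop (𝓝 0) := by
  have ht : Tendsto (fun n : ℕ => 2 * Real.pi * √((n : ℝ) / 6)) atTop atTop :=
    (Real.tendsto_sqrt_atTop.comp
      (tendsto_natCast_atTop_atTop.atTop_div_const (by norm_num))).const_mul_atTop (by positivity)
  -- The constant turns (2π√(n/6))² into 4n√3.
  have h1 := ((Real.tendsto_pow_mul_exp_neg_atTop_nhds_zero 2).comp ht).const_mul
    (6 * √3 / Real.pi ^ 2)
  have h2 := h1.mul (tendsto_partitionCount_mul.inv₀ one_ne_zero)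
  rw [mul_zero, zero_mul] at h2
  refine h2.congr' ?_
  filter_upwards [eventually_gt_atTop 0] with n hn
  have hn' : (n : ℝ) ≠ 0 := by exact_mod_cast hn.ne'
  simp only [Function.comp_apply, mul_pow, Real.sq_sqrt (show (0 : ℝ) ≤ (n : ℝ) / 6 by positivity)]
  field_simp
  norm_num

/-- Equidistribution of the rank modulo `t`. -/
lemma tendsto_rankCount_div_partitionCount (r t : ℕ) (hr : r < t) :
    Tendsto (fun n : ℕ => (rankCount r t n : ℝ) / (partitionCount n : ℝ)) atTop
      (𝓝 (1 / (t : ℝ))) := by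
  have ht : (0 : ℝ) < t := by exact_mod_cast (by omega : 0 < t)
  rw [← tendsto_add_atTop_iff_nat 2]
  have h1 : Tendsto (fun m : ℕ => 2 * (t : ℝ) ^ 2 *
      (1 - (partitionCount m : ℝ) / partitionCount (m + 2) + (partitionCount (m + 2) : ℝ)⁻¹))
      atTop (𝓝 0) := by
    have := ((tendsto_partitionCount_div_add_two.const_sub 1).add
      (tendsto_inv_partitionCount.comp (tendsto_add_atTop_nat 2))).const_mul (2 * (t : ℝ) ^ 2)
    simpa using! this
  have h2 : Tendsto (fun m : ℕ => (t : ℝ) * ((rankCount r t (m + 2) : ℝ) /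
      partitionCount (m + 2)) - 1) atTop (𝓝 0) := by
    refine squeeze_zero_norm (fun m => ?_) h1
    have hp : (0 : ℝ) < partitionCount (m + 2) := by
      exact_mod_cast (Fintype.card_pos : 0 < Fintype.card (Nat.Partition (m + 2)))
    have e : (t : ℝ) * ((rankCount r t (m + 2) : ℝ) / partitionCount (m + 2)) - 1 =
        (t * rankCount r t (m + 2) - partitionCount (m + 2)) / partitionCount (m + 2) := by
      field_simp
    rw [e, Real.norm_eq_abs, abs_div, abs_of_pos hp, div_le_iff₀ hp]
    refine (abs_mul_rankCount_sub_partitionCount_le r t m hr).trans (le_of_eq ?_)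
    field_simp
  have h3 := (h2.add_const 1).const_mul (1 / (t : ℝ))
  rw [zero_add, mul_one] at h3
  refine h3.congr fun m => ?_
  field_simp
  ring

theorem theorem1p1 (r t : ℕ) (ht : 2 ≤ t) (hr : r < t) :
    (fun n : ℕ => (rankCount r t n : ℝ)) ~[atTop] (fun n : ℕ => (1 / (t : ℝ)) * (partitionCount n : ℝ)) ∧
    (fun n : ℕ => (1 / (t : ℝ)) * (partitionCount n : ℝ)) ~[atTop]
      (fun n : ℕ => 1 / (4 * (t : ℝ) * (n : ℝ) * Real.sqrt 3) *
        Real.exp (2 * Real.pi * Real.sqrt ((n : ℝ) / 6))) ∧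
    Tendsto (fun n : ℕ => (rankCount r t n : ℝ) / (partitionCount n : ℝ)) atTop (𝓝 (1 / (t : ℝ))) := by
  have ht0 : (0 : ℝ) < t := by exact_mod_cast (by omega : 0 < t)
  have hlim := tendsto_rankCount_div_partitionCount r t hr
  refine ⟨?_, ?_, hlim⟩
  · refine (isEquivalent_iff_tendsto_one (Eventually.of_forall fun n => ?_)).2 ?_
    · have hp : (0 : ℝ) < partitionCount n := by
        exact_mod_cast (Fintype.card_pos : 0 < Fintype.card (Nat.Partition n))
      positivity
    · have h := hlim.const_mul (t : ℝ)
      rw [mul_one_div_cancel ht0.ne'] at h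
      refine h.congr fun n => ?_
      rw [Pi.div_apply]
      field_simp
  · refine ((IsEquivalent.refl (u := fun _ : ℕ => 1 / (t : ℝ))).mul
      isEquivalent_partitionCount).congr_right (Eventually.of_forall fun n => ?_)
    simp only [Pi.mul_apply]
    rw [← mul_assoc, one_div_mul_one_div]
    ring_nf
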